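/- Let $d\ge 1$, let $\Delta\ge\rho>0$, and let $K:\mathbb{R}^d\to\mathbb{R}$ be a shift-invariant kernel normalized by $K(0)=1$, with feature mapping $\varphi:\mathbb{R}^d\to\mathcal{H}$ into a real inner product space, i.e. $\langle\varphi(x),\varphi(y)\rangle=K(x-y)$ for all $x,y$. Let the frequencies of $K$ be distributed with a density $p$ on $\mathbb{R}^d$ that is the Fourier transform of $K$, i.e. $p$ is a probability density and $\int_{\mathbb{R}^d}p(\omega)e^{\mathrm{i}\langle\omega,x\rangle}\,\mathrm{d}\omega=K(x)$ for all $x$. For an integer $D\ge1$, the random Fourier feature (RFF) map with target dimension $D$ is $$\pi(x)=\tfrac{1}{\sqrt D}\bigl(\sin\langle\omega_1,x\rangle,\cos\langle\omega_1,x\rangle,\dots,\sin\langle\omega_D,x\rangle,\cos\langle\omega_D,x\rangle\bigr)\in\mathbb{R}^{2D},$$ with $\omega_1,\dots,\omega_D$ i.i.d. with density $p$. Write $\mathrm{dist}_\varphi(x,y)=\|\varphi(x)-\varphi(y)\|$ and $\mathrm{dist}_\pi(x,y)=\|\pi(x)-\pi(y)\|_2$. A point $x\in\mathbb{R}^d$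 is called $(\Delta,\rho)$-bounded if $|x_i|\le\Delta$ for all $i$ and $|x_i|\ge\rho$ for all $i$ with $x_i\ne0$. Put $$s_K(x)=\frac{1+K(2x)-2K(x)^2}{2(1-K(x))^2}\quad(x\neq 0),\qquad s_K^{(\Delta,\rho)}=\sup\{s_K(x): x\ne0\text{ is }(\Delta,\rho)\text{-bounded}\}.$$ Then $0<s_K^{(\Delta,\rho)}<\infty$, and there exist $(\Delta,\rho)$-bounded points $x,y\in\mathbb{R}^d$ with $\mathrm{dist}_\varphi(x,y)>0$ and a constant $C$ (depending on $K,\Delta,\rho$, but not on $\varepsilon$ or $D$) such that for every $0<\varepsilon<1$ and every integer $D\ge1$, $$\Pr\bigl[\,|\mathrm{dist}_\varphi(x,y)-\mathrm{dist}_\pi(x,y)|\ge\varepsilon\cdot\mathrm{dist}_\varphi(x,y)\,\bigr]\;\ge\;\frac{2}{\sqrt{2\pi}}\int_{6\varepsilon\sqrt{D/s_K^{(\Delta,\rho)}}}^{\infty}e^{-s^2/2}\,\mathrm{d}s\;-\;C\,D^{-1/2}.$$ -/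

import Mathlib

open MeasureTheory

namespace RFF

noncomputable section

/-- `ℝ^d` with its Euclidean inner product. -/
abbrev Space (d : ℕ) : Type := EuclideanSpace ℝ (Fin d)

/-- `x` is `(Δ, ρ)`-bounded: `‖x‖_∞ ≤ Δ`, and every non-zero coordinate of `x` has absolute
value at least `ρ`. -/
def IsBdd {d : ℕ} (Δ ρ : ℝ) (x : Space d) : Prop :=
  (∀ i, |x i| ≤ Δ) ∧ ∀ i, x i ≠ 0 → ρ ≤ |x i|

/-- `φ` is a feature mapping of the shift-invariant kernel `(x, y) ↦ K (x - y)`. -/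
def IsFeatureMap {d : ℕ} {H : Type*} [NormedAddCommGroup H] [InnerProductSpace ℝ H]
    (K : Space d → ℝ) (φ : Space d → H) : Prop :=
  ∀ x y, inner ℝ (φ x) (φ y) = K (x - y)

/-- `μ` is the law of the random frequencies of `K`: the probability measure on `ℝ^d` with a
density with respect to Lebesgue measure whose Fourier transform
`x ↦ ∫ exp (i ⟨ω, x⟩) dμ(ω)` is `K`. (So `K` is continuous and `K 0 = 1`.) -/
structure IsFrequencyLaw {d : ℕ} (K : Space d → ℝ) (μ : Measure (Space d)) : Prop where
  isProbabilityMeasure : IsProbabilityMeasure μ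
  absolutelyContinuous : μ ≪ volume
  charFun_eq : ∀ x, charFun μ x = (K x : ℂ)

/-- The random Fourier feature vector of `x` for the frequencies `ω 0, …, ω (D - 1)`: its entries
are `sin ⟨ω j, x⟩ / √D` and `cos ⟨ω j, x⟩ / √D`. -/
def features {d D : ℕ} (ω : Fin D → Space d) (x : Space d) : EuclideanSpace ℝ (Fin D × Fin 2) :=
  WithLp.toLp 2 fun j =>
    √(1 / (D : ℝ)) * ![Real.sin (inner ℝ (ω j.1) x), Real.cos (inner ℝ (ω j.1) x)] j.2

/-- The joint law of `D` independent samples from `μ`. -/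
def sampleLaw {d : ℕ} (μ : Measure (Space d)) (D : ℕ) : Measure (Fin D → Space d) :=
  Measure.pi fun _ => μ

/-- `s_K(x)`, the variance-to-squared-mean ratio at `x`. -/
def ratio {d : ℕ} (K : Space d → ℝ) (x : Space d) : ℝ :=
  (1 + K ((2 : ℝ) • x) - 2 * K x ^ 2) / (2 * (1 - K x) ^ 2)

/-- The values of `s_K` at the non-zero `(Δ, ρ)`-bounded points
(at the origin `s_K` is undefined, of the form `0 / 0`). -/
def ratioValues {d : ℕ} (K : Space d → ℝ) (Δ ρ : ℝ) : Set ℝ :=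
  ratio K '' {x | IsBdd Δ ρ x ∧ x ≠ 0}

/-- `s_K^{(Δ, ρ)}`, the supremum of `s_K` over the non-zero `(Δ, ρ)`-bounded points. -/
def ratioSup {d : ℕ} (K : Space d → ℝ) (Δ ρ : ℝ) : ℝ :=
  sSup (ratioValues K Δ ρ)

/-- The upper tail `Φ̄(t) = (2π)^{-1/2} ∫_t^∞ exp (-s² / 2) ds` of the standard normal law. -/
def gaussianTail (t : ℝ) : ℝ :=
  1 / √(2 * Real.pi) * ∫ s in Set.Ioi t, Real.exp (-s ^ 2 / 2)

end

end RFF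

namespace RFF

/-! The non-zero `(Δ, ρ)`-bounded points form a compact set, so `ratio K` attains its supremum at
some `z`; the hard pair is `z, 0`. There the difference of the squared distances is `2τ / √D` times
a normalized sum of i.i.d. bounded variables `Y (ω j)`, where `τ` is the standard deviation of `cos
⟨ω, z⟩`. A relative error `3ε` in squared distance forces a relative error `ε` in distance
(`le_abs_sub_of_le_abs_sq_sub`), so it suffices that the normalized sum is at least `t = 3ε√(D /
s_K)` in absolute value with the claimed probability.

The claim has the Gaussian tail at `2t`, not `t`. This slack replaces the full Berry–Esseen theorem
by the one-sided bound `P(|S| < t) ≤ gaussianMass (2t) + C / √D`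
(`exists_pi_measureReal_abs_sum_lt_le`). Its proof tests `P` and the Gaussian against the indicator
of `[-3t/2, 3t/2]` convolved with a Fejér kernel. This function is band-limited, so its two
integrals are compared through characteristic functions at frequencies up to order `√D`, where the
usual i.i.d. estimate holds. -/

/-! ### The Fejér kernel: Fourier representation, mass and tails. -/

/-- The Fejér kernel with frequencies in `[-R, R]`. -/
noncomputable def fejer (R z : ℝ) : ℝ := R * Real.sinc (R * z / 2) ^ 2

/-- The triangle vanishes beyond `R`; this is what makes smoothing by `fejer R` band-limited. An
explicit antiderivative does the computation, with `z = 0` apart because it divides by `z`. -/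
theorem integral_triangle_mul_cos {R : ℝ} (hR : 0 < R) (z : ℝ) :
    ∫ v in (0 : ℝ)..R, 2 * (1 - v / R) * Real.cos (v * z) = fejer R z := by
  have hR' := hR.ne'
  rcases eq_or_ne z 0 with rfl | hz
  · have : ∀ v ∈ Set.uIcc 0 R, HasDerivAt (fun v : ℝ => 2 * v - v ^ 2 / R)
        (2 * (1 - v / R) * Real.cos (v * 0)) v := by
      intro v _
      have h := ((hasDerivAt_id v).const_mul 2).sub (((hasDerivAt_id v).pow 2).div_const R)
      exact h.congr_deriv (by simp; ring)
    rw [intervalIntegral.integral_eq_sub_of_hasDerivAt this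
      (by apply Continuous.intervalIntegrable; fun_prop)]
    simp [fejer]
    field_simp
    ring
  · have : ∀ v ∈ Set.uIcc 0 R, HasDerivAt
        (fun v : ℝ => 2 * (1 - v / R) * (Real.sin (v * z) / z) - 2 * Real.cos (v * z) / (R * z ^ 2))
        (2 * (1 - v / R) * Real.cos (v * z)) v := by
      intro v _
      have hvz : HasDerivAt (fun v : ℝ => v * z) z v := by
        simpa using (hasDerivAt_id v).mul_const z
      have h1 : HasDerivAt (fun v : ℝ => 2 * (1 - v / R)) (2 * (0 - 1 / R)) v :=
        ((hasDerivAt_const v (1 : ℝ)).sub ((hasDerivAt_id v).div_const R)).const_mul 2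
      have h := (h1.mul (hvz.sin.div_const z)).sub
        ((hvz.cos.const_mul 2).div_const (R * z ^ 2))
      exact h.congr_deriv (by field_simp; ring)
    rw [intervalIntegral.integral_eq_sub_of_hasDerivAt this
      (by apply Continuous.intervalIntegrable; fun_prop)]
    have h2 : R * z / 2 ≠ 0 := by positivity
    rw [fejer, Real.sinc_of_ne_zero h2]
    have hc : Real.cos (R * z) = 1 - 2 * Real.sin (R * z / 2) ^ 2 := by
      have := Real.cos_two_mul (R * z / 2)
      rw [show 2 * (R * z / 2) = R * z by ring] at this
      rw [this, Real.cos_sq']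
      ring
    rw [hc]
    simp
    field_simp
    ring

theorem fejer_nonneg {R : ℝ} (hR : 0 < R) (z : ℝ) : 0 ≤ fejer R z := by
  unfold fejer; positivity

theorem continuous_fejer (R : ℝ) : Continuous (fejer R) := by
  unfold fejer
  have := Real.continuous_sinc
  fun_prop

theorem fejer_le {R : ℝ} (hR : 0 < R) {z : ℝ} (hz : z ≠ 0) : fejer R z ≤ 4 / R * (z ^ 2)⁻¹ := by
  have h2 : R * z / 2 ≠ 0 := by have := hR.ne'; positivity
  rw [fejer, Real.sinc_of_ne_zero h2]
  have hs : Real.sin (R * z / 2) ^ 2 ≤ 1 := Real.sin_sq_le_one _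
  calc R * (Real.sin (R * z / 2) / (R * z / 2)) ^ 2
      = 4 / R * (z ^ 2)⁻¹ * Real.sin (R * z / 2) ^ 2 := by field_simp; ring
    _ ≤ 4 / R * (z ^ 2)⁻¹ * 1 := by gcongr
    _ = _ := mul_one _

theorem fejer_eq_scale (R z : ℝ) : fejer R z = R * fejer 1 (R * z) := by simp [fejer]

theorem integrable_fejer_one : Integrable (fejer 1) := by
  refine (integrable_inv_one_add_sq.const_mul 5).mono'
    (continuous_fejer 1).aestronglyMeasurable (Filter.Eventually.of_forall fun z => ?_)
  rw [Real.norm_of_nonneg (fejer_nonneg one_pos z), ← div_eq_mul_inv,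
    le_div_iff₀ (by positivity)]
  have h1 : fejer 1 z ≤ 1 := by
    have := Real.abs_sinc_le_one (1 * z / 2)
    rw [fejer, one_mul]
    exact (sq_le_one_iff_abs_le_one _).2 this
  rcases eq_or_ne z 0 with rfl | hz
  · simp; linarith
  · have h2 := fejer_le one_pos hz
    rw [div_one, ← div_eq_mul_inv, le_div_iff₀ (by positivity)] at h2
    linarith

/-- The total mass of the Fejér kernel. -/
noncomputable def fejerMass : ℝ := ∫ z, fejer 1 z

theorem fejerMass_pos : 0 < fejerMass := by
  refine integral_pos_of_integrable_nonneg_nonzero (x := 0) (continuous_fejer 1)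
    integrable_fejer_one (fun z => fejer_nonneg one_pos z) ?_
  simp [fejer]

theorem integrable_fejer {R : ℝ} (hR : 0 < R) : Integrable (fejer R) := by
  have := (integrable_fejer_one.comp_mul_left' hR.ne').const_mul R
  exact this.congr (Filter.Eventually.of_forall fun z => (fejer_eq_scale R z).symm)

theorem integral_fejer {R : ℝ} (hR : 0 < R) : ∫ z, fejer R z = fejerMass := by
  simp_rw [fejer_eq_scale R]
  rw [integral_const_mul, Measure.integral_comp_mul_left, smul_eq_mul, fejerMass,
    abs_of_pos (inv_pos.2 hR), ← mul_assoc, mul_inv_cancel₀ hR.ne', one_mul]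

theorem integrableOn_Ioi_inv_sq {s : ℝ} (hs : 0 < s) :
    IntegrableOn (fun z : ℝ => (z ^ 2)⁻¹) (Set.Ioi s) := by
  refine (integrableOn_Ioi_rpow_of_lt (a := -2) (by norm_num) hs).congr_fun ?_ measurableSet_Ioi
  intro z hz
  have hz' : 0 ≤ z := hs.le.trans (le_of_lt hz)
  simp [Real.rpow_neg hz']

theorem integral_Ioi_inv_sq {s : ℝ} (hs : 0 < s) :
    ∫ z in Set.Ioi s, (z ^ 2)⁻¹ = s⁻¹ := by
  have h := integral_Ioi_rpow_of_lt (a := -2) (by norm_num) hs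
  rw [setIntegral_congr_fun measurableSet_Ioi (g := fun z : ℝ => (z ^ 2)⁻¹)
    (f := fun z : ℝ => z ^ (-2 : ℝ))] at h
  · rw [h, show (-2 : ℝ) + 1 = -1 by norm_num, Real.rpow_neg_one]; ring
  · intro z hz
    have hz' : 0 ≤ z := hs.le.trans (le_of_lt hz)
    simp [Real.rpow_neg hz']

theorem compl_Ioc_neg_eq {s : ℝ} : (Set.Ioc (-s) s)ᶜ = Set.Iic (-s) ∪ Set.Ioi s := by
  ext z
  simp only [Set.mem_compl_iff, Set.mem_Ioc, Set.mem_union, Set.mem_Iic, Set.mem_Ioi]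
  grind

theorem integrableOn_compl_inv_sq {s : ℝ} (hs : 0 < s) :
    IntegrableOn (fun z : ℝ => (z ^ 2)⁻¹) (Set.Ioc (-s) s)ᶜ := by
  rw [compl_Ioc_neg_eq]
  refine IntegrableOn.union ?_ (integrableOn_Ioi_inv_sq hs)
  have := integrableOn_Ici_iff_integrableOn_Ioi (μ := volume) |>.2 (integrableOn_Ioi_inv_sq hs)
  rw [← neg_neg s] at this
  simpa using this.comp_neg_Iic

theorem integral_compl_inv_sq {s : ℝ} (hs : 0 < s) :
    ∫ z in (Set.Ioc (-s) s)ᶜ, (z ^ 2)⁻¹ = 2 / s := by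
  have hi := integrableOn_compl_inv_sq hs
  rw [compl_Ioc_neg_eq] at hi ⊢
  rw [setIntegral_union (Set.Iic_disjoint_Ioi (by linarith)) measurableSet_Ioi
    (hi.mono_set Set.subset_union_left) (hi.mono_set Set.subset_union_right)]
  have h := integral_comp_neg_Iic (-s) (fun z : ℝ => (z ^ 2)⁻¹)
  simp only [even_two, Even.neg_pow, neg_neg] at h
  rw [h, integral_Ioi_inv_sq hs]
  ring

/-- The mass lost outside the interval is controlled by integrating the tail bound `4 / (R z²)`. -/
theorem le_integral_fejer {R s : ℝ} (hR : 0 < R) (hs : 0 < s) :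
    fejerMass - 8 / (R * s) ≤ ∫ z in Set.Ioc (-s) s, fejer R z := by
  have h1 := integral_add_compl (μ := volume) (f := fejer R) (measurableSet_Ioc (a := -s) (b := s))
    (integrable_fejer hR)
  rw [integral_fejer hR] at h1
  have h2 : ∫ z in (Set.Ioc (-s) s)ᶜ, fejer R z
      ≤ ∫ z in (Set.Ioc (-s) s)ᶜ, 4 / R * (z ^ 2)⁻¹ := by
    refine setIntegral_mono_on (integrable_fejer hR).integrableOn
      ((integrableOn_compl_inv_sq hs).const_mul _) measurableSet_Ioc.compl fun z hz => ?_
    refine fejer_le hR ?_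
    rintro rfl
    exact hz ⟨by linarith, hs.le⟩
  rw [integral_const_mul, integral_compl_inv_sq hs] at h2
  have : 4 / R * (2 / s) = 8 / (R * s) := by field_simp; ring
  linarith

/-! ### The smoothed indicator: pointwise bounds and Fourier comparison. -/

/-- The indicator of `[-a, a]`, smoothed by the Fejér kernel. -/
noncomputable def smoothInd (R a x : ℝ) : ℝ := ∫ y in -a..a, fejer R (x + y)

theorem smoothInd_eq {R a : ℝ} (x : ℝ) :
    smoothInd R a x = ∫ z in (x - a)..(x + a), fejer R z := by
  rw [smoothInd, intervalIntegral.integral_comp_add_left (fun z => fejer R z)]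
  rfl

theorem smoothInd_nonneg {R a : ℝ} (hR : 0 < R) (ha : 0 ≤ a) (x : ℝ) : 0 ≤ smoothInd R a x :=
  intervalIntegral.integral_nonneg (by linarith) fun _ _ => fejer_nonneg hR _

theorem smoothInd_le {R a : ℝ} (hR : 0 < R) (ha : 0 ≤ a) (x : ℝ) :
    smoothInd R a x ≤ fejerMass := by
  rw [smoothInd_eq, intervalIntegral.integral_of_le (by linarith), ← integral_fejer hR]
  exact setIntegral_le_integral (integrable_fejer hR)
    (Filter.Eventually.of_forall fun z => fejer_nonneg hR z)

/-- The window `(x - 3t/2, x + 3t/2]` contains `(-t/2, t/2]`, where the kernel concentrates. -/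
theorem le_smoothInd {R t x : ℝ} (hR : 0 < R) (ht : 0 < t) (hx : |x| ≤ t) :
    fejerMass - 16 / (R * t) ≤ smoothInd R (3 / 2 * t) x := by
  have h := le_integral_fejer hR (half_pos ht)
  rw [show 8 / (R * (t / 2)) = 16 / (R * t) by field_simp; ring] at h
  refine h.trans ?_
  rw [abs_le] at hx
  rw [smoothInd_eq, intervalIntegral.integral_of_le (by linarith)]
  refine setIntegral_mono_set (integrable_fejer hR).integrableOn
    (Filter.Eventually.of_forall fun z => fejer_nonneg hR z) ?_
  exact (Set.Ioc_subset_Ioc (by linarith) (by linarith)).eventuallyLE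

theorem smoothInd_le_of_le_abs {R t x : ℝ} (hR : 0 < R) (ht : 0 < t) (hx : 2 * t ≤ |x|) :
    smoothInd R (3 / 2 * t) x ≤ 192 * t / R * (x ^ 2)⁻¹ := by
  have hx0 : 0 < |x| := by linarith
  have h : ∀ y ∈ Set.Icc (-(3 / 2 * t)) (3 / 2 * t), fejer R (x + y) ≤ 64 / R * (x ^ 2)⁻¹ := by
    intro y hy
    have hy' : |y| ≤ 3 / 2 * t := abs_le.2 hy
    -- Since `2t ≤ |x|`, `|y| ≤ 3t/2 ≤ 3|x|/4`.
    have h1 : |x| / 4 ≤ |x + y| := by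
      have := abs_sub_abs_le_abs_sub x (-y)
      rw [abs_neg, sub_neg_eq_add] at this
      linarith
    have h2 : x + y ≠ 0 := by
      intro h0
      rw [h0, abs_zero] at h1
      linarith
    refine (fejer_le hR h2).trans ?_
    have h3 : x ^ 2 / 16 ≤ (x + y) ^ 2 := by
      rw [← sq_abs x, ← sq_abs (x + y)]
      have := mul_self_le_mul_self (by positivity) h1
      nlinarith
    have hx2 : 0 < x ^ 2 := by rw [← sq_abs]; positivity
    have h4 := inv_anti₀ (by positivity) h3
    calc 4 / R * ((x + y) ^ 2)⁻¹ ≤ 4 / R * (x ^ 2 / 16)⁻¹ := by gcongr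
      _ = _ := by field_simp; ring
  calc smoothInd R (3 / 2 * t) x
      ≤ ∫ y in -(3 / 2 * t)..(3 / 2 * t), 64 / R * (x ^ 2)⁻¹ := by
        refine intervalIntegral.integral_mono_on (by linarith) ?_ (by simp) h
        exact ((continuous_fejer R).comp (by fun_prop)).intervalIntegrable _ _
    _ = _ := by
        rw [intervalIntegral.integral_const, smul_eq_mul]
        ring

theorem integral_cos_mul_add {a : ℝ} (v x : ℝ) :
    ∫ y in -a..a, Real.cos (v * (x + y)) = 2 * a * Real.sinc (v * a) * Real.cos (v * x) := by
  rcases eq_or_ne v 0 with rfl | hv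
  · simp; ring
  rcases eq_or_ne a 0 with rfl | ha
  · simp
  have h := intervalIntegral.integral_comp_mul_add (a := -a) (b := a) Real.cos hv (v * x)
  simp_rw [show ∀ y, v * (x + y) = v * y + v * x by intro y; ring]
  rw [h, integral_cos, Real.sinc_of_ne_zero (mul_ne_zero hv ha), Real.sin_add, Real.sin_add,
    mul_neg, Real.sin_neg, Real.cos_neg, smul_eq_mul]
  field_simp
  ring

/-- The Fourier transform of `smoothInd R a`. -/
noncomputable def smoothWeight (R a v : ℝ) : ℝ := 4 * (1 - v / R) * a * Real.sinc (v * a)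

theorem continuous_smoothWeight (R a : ℝ) : Continuous (smoothWeight R a) := by
  unfold smoothWeight
  have := Real.continuous_sinc
  fun_prop

theorem smoothInd_eq_fourier {R : ℝ} (hR : 0 < R) (a x : ℝ) :
    smoothInd R a x = ∫ v in (0 : ℝ)..R, smoothWeight R a v * Real.cos (v * x) := by
  simp_rw [smoothInd, ← integral_triangle_mul_cos hR]
  rw [intervalIntegral_intervalIntegral_swap]
  · refine intervalIntegral.integral_congr fun v _ => ?_
    simp only [intervalIntegral.integral_const_mul, integral_cos_mul_add, smoothWeight]
    ring
  · refine IntegrableOn.mono_set ?_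
      (Set.prod_mono (Set.uIoc_subset_uIcc (a := -a) (b := a)) (Set.uIoc_subset_uIcc (a := 0) (b := R)))
    refine ContinuousOn.integrableOn_compact (isCompact_uIcc.prod isCompact_uIcc) ?_
    simp only [Function.uncurry_def]
    fun_prop

theorem continuous_smoothInd (R a : ℝ) : Continuous (smoothInd R a) := by
  refine intervalIntegral.continuous_parametric_intervalIntegral_of_continuous' ?_ _ _
  have := continuous_fejer R
  simp only [Function.uncurry_def]
  fun_prop

theorem integral_smoothInd {R : ℝ} (hR : 0 < R) (a : ℝ) (P : Measure ℝ) [IsFiniteMeasure P] :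
    ∫ x, smoothInd R a x ∂P
      = ∫ v in (0 : ℝ)..R, smoothWeight R a v * ∫ x, Real.cos (v * x) ∂P := by
  simp_rw [smoothInd_eq_fourier hR, ← integral_const_mul]
  rw [intervalIntegral_integral_swap]
  have h1 : Integrable (smoothWeight R a) (volume.restrict (Set.uIoc 0 R)) :=
    ((continuous_smoothWeight R a).continuousOn.integrableOn_compact isCompact_uIcc).mono_set
      Set.uIoc_subset_uIcc
  have h2 := h1.mul_prod (integrable_const (μ := P) (1 : ℝ))
  refine h2.mono ?_ (Filter.Eventually.of_forall fun z => ?_)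
  · have := continuous_smoothWeight R a
    refine Continuous.aestronglyMeasurable ?_
    simp only [Function.uncurry_def]
    fun_prop
  · simp only [Function.uncurry_def, norm_mul, norm_one]
    gcongr
    exact Real.abs_cos_le_one _

/-- The bound is uniform in `a`, hence in the threshold `t`; the pole at `v = 0` is absorbed by the
factor `v ^ 3` in the characteristic function estimate. -/
theorem abs_smoothWeight_le {R a v : ℝ} (ha : 0 ≤ a) (hv : 0 < v) (hvR : v ≤ R) :
    |smoothWeight R a v| ≤ 4 / v := by
  have hR : 0 < R := hv.trans_le hvR
  have h1 : |1 - v / R| ≤ 1 := by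
    have : v / R ≤ 1 := (div_le_one hR).2 hvR
    have : 0 ≤ v / R := by positivity
    rw [abs_le]; constructor <;> linarith
  have h2 : |a * Real.sinc (v * a)| ≤ 1 / v := by
    rcases ha.eq_or_lt with rfl | ha
    · simp; exact hv.le
    · rw [Real.sinc_of_ne_zero (by positivity), show a * (Real.sin (v * a) / (v * a))
        = Real.sin (v * a) / v by field_simp, abs_div, abs_of_pos hv]
      gcongr
      exact Real.abs_sin_le_one _
  calc |smoothWeight R a v| = 4 * |1 - v / R| * |a * Real.sinc (v * a)| := by
        rw [smoothWeight, mul_assoc, abs_mul, abs_mul, abs_of_pos (by norm_num : (0:ℝ) < 4)]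
    _ ≤ 4 * 1 * (1 / v) := by gcongr
    _ = 4 / v := by ring

theorem sq_mul_exp_neg_le (v : ℝ) : v ^ 2 * Real.exp (-v ^ 2 / 4) ≤ 32 * (1 + v ^ 2)⁻¹ := by
  have h := Real.quadratic_le_exp_of_nonneg (x := v ^ 2 / 4) (by positivity)
  rw [show -v ^ 2 / 4 = -(v ^ 2 / 4) by ring, Real.exp_neg, ← div_eq_mul_inv, ← div_eq_mul_inv,
    div_le_div_iff₀ (Real.exp_pos _) (by positivity)]
  nlinarith [sq_nonneg v, sq_nonneg (v ^ 2)]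

theorem abs_integral_smoothInd_sub_le {R a A : ℝ} (hR : 0 < R) (ha : 0 ≤ a) (hA : 0 ≤ A)
    (P Q : Measure ℝ) [IsFiniteMeasure P] [IsFiniteMeasure Q]
    (h : ∀ v, 0 < v → v ≤ R → |∫ x, Real.cos (v * x) ∂P - ∫ x, Real.cos (v * x) ∂Q|
      ≤ A * v ^ 3 * Real.exp (-v ^ 2 / 4)) :
    |∫ x, smoothInd R a x ∂P - ∫ x, smoothInd R a x ∂Q| ≤ 256 * A := by
  have hc (P : Measure ℝ) [IsFiniteMeasure P] :
      IntervalIntegrable (fun v => smoothWeight R a v * ∫ x, Real.cos (v * x) ∂P) volume 0 R := by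
    refine Continuous.intervalIntegrable ?_ _ _
    refine (continuous_smoothWeight R a).mul ?_
    refine continuous_of_dominated (bound := fun _ => 1) (fun v => ?_) (fun v => ?_)
      (integrable_const _) ?_
    · exact (by fun_prop : Continuous fun x => Real.cos (v * x)).aestronglyMeasurable
    · exact Filter.Eventually.of_forall fun x => Real.abs_cos_le_one _
    · exact Filter.Eventually.of_forall fun x => by fun_prop
  rw [integral_smoothInd hR, integral_smoothInd hR, ← intervalIntegral.integral_sub (hc P) (hc Q)]
  have key : ∀ v ∈ Set.Ioc 0 R, ‖smoothWeight R a v * ∫ x, Real.cos (v * x) ∂P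
      - smoothWeight R a v * ∫ x, Real.cos (v * x) ∂Q‖ ≤ 128 * A * (1 / (1 + v ^ 2)) := by
    rintro v ⟨hv, hvR⟩
    rw [← mul_sub, norm_mul, Real.norm_eq_abs, Real.norm_eq_abs]
    calc _ ≤ 4 / v * (A * v ^ 3 * Real.exp (-v ^ 2 / 4)) :=
          mul_le_mul (abs_smoothWeight_le ha hv hvR) (h v hv hvR) (abs_nonneg _) (by positivity)
      _ = 4 * A * (v ^ 2 * Real.exp (-v ^ 2 / 4)) := by field_simp
      _ ≤ 4 * A * (32 * (1 + v ^ 2)⁻¹) := mul_le_mul_of_nonneg_left (sq_mul_exp_neg_le v) (by positivity)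
      _ = _ := by ring
  have hint : IntervalIntegrable (fun v : ℝ => 128 * A * (1 / (1 + v ^ 2))) volume 0 R :=
    (continuous_const.mul (continuous_const.div (by fun_prop)
      fun x => by positivity)).intervalIntegrable _ _
  have h2 := intervalIntegral.norm_integral_le_of_norm_le hR.le
    (Filter.Eventually.of_forall key) hint
  rw [Real.norm_eq_abs] at h2
  refine h2.trans ?_
  rw [intervalIntegral.integral_const_mul, integral_one_div_one_add_sq, Real.arctan_zero, sub_zero]
  have : Real.arctan R ≤ 2 := by
    have := Real.arctan_lt_pi_div_two R
    have := Real.pi_lt_four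
    linarith
  nlinarith

open ProbabilityTheory

/-! ### Gaussian masses and the two test-function integrals. -/

theorem gaussianPDFReal_le_one (x : ℝ) : gaussianPDFReal 0 1 x ≤ 1 := by
  have h1 : (1 : ℝ) ≤ √(2 * Real.pi) := by
    rw [Real.one_le_sqrt]
    have := Real.pi_gt_three
    linarith
  simp only [gaussianPDFReal, NNReal.coe_one, mul_one, sub_zero]
  refine mul_le_one₀ (inv_le_one_of_one_le₀ h1) (Real.exp_pos _).le ?_
  rw [Real.exp_le_one_iff]
  have := sq_nonneg x
  linarith

/-- The standard normal mass of `(-s, s]`. -/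
noncomputable def gaussianMass (s : ℝ) : ℝ := ∫ x in Set.Ioc (-s) s, gaussianPDFReal 0 1 x

theorem gaussianMass_nonneg (s : ℝ) : 0 ≤ gaussianMass s :=
  integral_nonneg fun x => gaussianPDFReal_nonneg 0 1 x

theorem gaussianMass_le {s : ℝ} (hs : 0 ≤ s) : gaussianMass s ≤ 2 * s := by
  have h := setIntegral_mono_on (s := Set.Ioc (-s) s)
    (integrable_gaussianPDFReal 0 1).integrableOn
    (integrableOn_const (μ := volume) (C := (1 : ℝ)) (by simp)) measurableSet_Ioc
    fun x _ => gaussianPDFReal_le_one x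
  refine h.trans (le_of_eq ?_)
  rw [setIntegral_const, smul_eq_mul, Real.volume_real_Ioc_of_le (by linarith)]
  ring

theorem gaussianMass_add_gaussianTail {s : ℝ} (hs : 0 ≤ s) :
    gaussianMass s + 2 * gaussianTail s = 1 := by
  have hi := integrable_gaussianPDFReal 0 1
  have h1 := integral_add_compl (measurableSet_Ioc (a := -s) (b := s)) hi
  rw [integral_gaussianPDFReal_eq_one 0 one_ne_zero, compl_Ioc_neg_eq,
    setIntegral_union (Set.Iic_disjoint_Ioi (by linarith)) measurableSet_Ioi
    hi.integrableOn hi.integrableOn, ← integral_comp_neg_Ioi] at h1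
  have h2 : ∫ x in Set.Ioi s, gaussianPDFReal 0 1 x = gaussianTail s := by
    simp [gaussianTail, gaussianPDFReal, integral_const_mul]
  have h3 : ∀ x, gaussianPDFReal 0 1 (-x) = gaussianPDFReal 0 1 x := by
    intro x; simp [gaussianPDFReal]
  simp_rw [h3] at h1
  rw [h2] at h1
  rw [gaussianMass]
  linarith

theorem integrable_smoothInd {R a : ℝ} (hR : 0 < R) (ha : 0 ≤ a) (P : Measure ℝ)
    [IsFiniteMeasure P] : Integrable (smoothInd R a) P := by
  refine (integrable_const fejerMass).mono' (continuous_smoothInd R a).aestronglyMeasurable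
    (Filter.Eventually.of_forall fun x => ?_)
  rw [Real.norm_of_nonneg (smoothInd_nonneg hR ha x)]
  exact smoothInd_le hR ha x

/-- Inside `(-2t, 2t]` the test function is at most `fejerMass`; outside, its decay integrates to
`192 / R`, with `t` cancelling. This is where the interval doubles. -/
theorem integral_smoothInd_gaussian_le {R t : ℝ} (hR : 0 < R) (ht : 0 < t) :
    ∫ x, smoothInd R (3 / 2 * t) x ∂(gaussianReal 0 1)
      ≤ fejerMass * gaussianMass (2 * t) + 192 / R := by
  have ha : 0 ≤ 3 / 2 * t := by positivity
  have hF0 := smoothInd_nonneg hR ha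
  have hi : Integrable fun x => gaussianPDFReal 0 1 x * smoothInd R (3 / 2 * t) x := by
    refine ((integrable_gaussianPDFReal 0 1).mul_const fejerMass).mono' ?_
      (Filter.Eventually.of_forall fun x => ?_)
    · exact ((measurable_gaussianPDFReal 0 1).mul
        (continuous_smoothInd R _).measurable).aestronglyMeasurable
    · rw [Real.norm_of_nonneg (mul_nonneg (gaussianPDFReal_nonneg _ _ _) (hF0 x))]
      exact mul_le_mul_of_nonneg_left (smoothInd_le hR ha x) (gaussianPDFReal_nonneg _ _ _)
  rw [integral_gaussianReal_eq_integral_smul one_ne_zero]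
  simp only [smul_eq_mul]
  rw [← integral_add_compl (measurableSet_Ioc (a := -(2 * t)) (b := 2 * t)) hi]
  refine add_le_add ?_ ?_
  · rw [gaussianMass, ← integral_const_mul]
    refine setIntegral_mono_on hi.integrableOn
      ((integrable_gaussianPDFReal 0 1).const_mul _).integrableOn measurableSet_Ioc fun x _ => ?_
    rw [mul_comm]
    exact mul_le_mul_of_nonneg_right (smoothInd_le hR ha x) (gaussianPDFReal_nonneg _ _ _)
  · have h2t : 0 < 2 * t := by positivity
    have h := setIntegral_mono_on hi.integrableOn
      ((integrableOn_compl_inv_sq h2t).const_mul (192 * t / R)) measurableSet_Ioc.compl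
      (fun x hx => ?_)
    · refine h.trans (le_of_eq ?_)
      rw [integral_const_mul, integral_compl_inv_sq h2t]
      field_simp
    · have hx' : 2 * t ≤ |x| := by
        rw [compl_Ioc_neg_eq] at hx
        rcases hx with hx | hx
        · rw [Set.mem_Iic] at hx
          linarith [neg_le_abs x]
        · exact (le_of_lt hx).trans (le_abs_self x)
      calc _ ≤ 1 * smoothInd R (3 / 2 * t) x :=
            mul_le_mul_of_nonneg_right (gaussianPDFReal_le_one x) (hF0 x)
        _ ≤ _ := by rw [one_mul]; exact smoothInd_le_of_le_abs hR ht hx'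

theorem integral_cos_gaussianReal (v : ℝ) :
    ∫ x, Real.cos (v * x) ∂(gaussianReal 0 1) = Real.exp (-v ^ 2 / 2) := by
  have h := charFun_gaussianReal (μ := 0) (v := 1) v
  rw [charFun_apply_real] at h
  have h2 := congrArg Complex.re h
  rw [← RCLike.re_eq_complex_re, ← integral_re] at h2
  · simp only [RCLike.re_eq_complex_re, ← Complex.ofReal_mul, Complex.exp_ofReal_mul_I_re] at h2
    rw [h2]
    have : (((v * 0 : ℝ) : ℂ) * Complex.I - ((1 : NNReal) : ℝ) * (v : ℂ) ^ 2 / 2)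
        = ((-v ^ 2 / 2 : ℝ) : ℂ) := by push_cast; ring
    rw [this, ← Complex.ofReal_exp, Complex.ofReal_re]
  · refine (integrable_const (1 : ℝ)).mono' ?_ (Filter.Eventually.of_forall fun x => ?_)
    · exact Continuous.aestronglyMeasurable (by fun_prop)
    · rw [← Complex.ofReal_mul, Complex.norm_exp_ofReal_mul_I]

theorem mul_measureReal_le_integral_smoothInd {R t : ℝ} (hR : 0 < R) (ht : 0 < t)
    (P : Measure ℝ) [IsFiniteMeasure P] :
    (fejerMass - 16 / (R * t)) * P.real {x | |x| < t} ≤ ∫ x, smoothInd R (3 / 2 * t) x ∂P := by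
  have ha : 0 ≤ 3 / 2 * t := by positivity
  have hm : MeasurableSet {x : ℝ | |x| < t} := measurableSet_lt (by fun_prop) (by fun_prop)
  have hi := integrable_smoothInd hR ha P
  calc _ = ∫ x in {x | |x| < t}, (fejerMass - 16 / (R * t)) ∂P := by
        rw [setIntegral_const, smul_eq_mul, mul_comm]
    _ ≤ ∫ x in {x | |x| < t}, smoothInd R (3 / 2 * t) x ∂P :=
        setIntegral_mono_on (integrableOn_const (by simp)) hi.integrableOn hm
          fun x hx => le_smoothInd hR ht (le_of_lt hx)
    _ ≤ _ := setIntegral_le_integral hi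
        (Filter.Eventually.of_forall fun x => smoothInd_nonneg hR ha x)

/-! ### The smoothing inequality. -/

/-- A one-sided smoothing inequality: closeness to the standard normal characteristic function on
`[0, r / δ]` bounds the mass near the origin by a Gaussian mass on the doubled interval. -/
theorem exists_measureReal_abs_lt_le {r A : ℝ} (hr : 0 < r) (hA : 0 ≤ A) :
    ∃ C : ℝ, ∀ δ : ℝ, 0 < δ → ∀ P : Measure ℝ, IsProbabilityMeasure P →
      (∀ v, 0 < v → v ≤ r / δ → |∫ x, Real.cos (v * x) ∂P - Real.exp (-v ^ 2 / 2)|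
        ≤ A * δ * v ^ 3 * Real.exp (-v ^ 2 / 4)) →
      ∀ t, 0 < t → P.real {x | |x| < t} ≤ gaussianMass (2 * t) + C * δ := by
  have hc := fejerMass_pos
  set c := fejerMass with hcdef
  set B := 192 / r + 256 * A with hB
  have hB0 : 0 ≤ B := by positivity
  refine ⟨(2 * B + 256 / r) / c, fun δ hδ P _ hP t ht => ?_⟩
  have hR : 0 < r / δ := by positivity
  -- The smoothing bound still carries the loss `16δ / (rt)`, which is not uniformly `O(δ)` as `t →
  -- 0`.
  have main : ∀ t, 0 < t → (c - 16 * δ / (r * t)) * P.real {x | |x| < t}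
      ≤ c * gaussianMass (2 * t) + B * δ := by
    intro t ht
    have h1 := mul_measureReal_le_integral_smoothInd hR ht P
    have h2 := abs_integral_smoothInd_sub_le hR (a := 3 / 2 * t) (A := A * δ) (by positivity)
      (by positivity) P (gaussianReal 0 1) (fun v hv hvR => by
        rw [integral_cos_gaussianReal]; exact hP v hv hvR)
    have h3 := integral_smoothInd_gaussian_le hR ht
    have h4 := (abs_le.1 h2).2
    rw [show 16 / (r / δ * t) = 16 * δ / (r * t) by field_simp] at h1
    rw [show 192 / (r / δ) = 192 / r * δ by field_simp] at h3
    rw [hB]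
    linarith
  -- From this threshold on the loss is at most `c / 2`, which yields the linear bound `P(|x| < t) =
  -- O(t + δ)`.
  have crude : ∀ t, 32 * δ / (c * r) ≤ t →
      P.real {x | |x| < t} ≤ 8 * t + 2 * B / c * δ ∧ 16 * δ / (r * t) ≤ c / 2 := by
    intro t ht
    have ht0 : 0 < t := lt_of_lt_of_le (by positivity) ht
    have h1 : 16 * δ / (r * t) ≤ c / 2 := by
      rw [div_le_iff₀ (by positivity)] at ht ⊢
      linarith
    refine ⟨?_, h1⟩
    have h2 := main t ht0
    have h3 : gaussianMass (2 * t) ≤ 4 * t := by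
      have := gaussianMass_le (s := 2 * t) (by positivity); linarith
    have h4 : c / 2 * P.real {x | |x| < t} ≤ (c - 16 * δ / (r * t)) * P.real {x | |x| < t} :=
      mul_le_mul_of_nonneg_right (by linarith) measureReal_nonneg
    have h5 : c * gaussianMass (2 * t) ≤ c * (4 * t) := by gcongr
    have h6 : c / 2 * (8 * t + 2 * B / c * δ) = c * (4 * t) + B * δ := by field_simp; ring
    refine le_of_mul_le_mul_left ?_ (half_pos hc)
    linarith
  -- Bootstrap: for large `t`, the crude bound turns loss times probability into `O(δ)`, as `t`
  -- cancels. For small `t`, monotonicity and the crude bound at the threshold suffice.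
  rcases le_total (32 * δ / (c * r)) t with h | h
  · obtain ⟨h1, h2⟩ := crude t h
    have h3 := main t ht
    have h4 : 16 * δ / (r * t) * P.real {x | |x| < t}
        ≤ 16 * δ / (r * t) * (8 * t + 2 * B / c * δ) := by gcongr
    have h5 : 16 * δ / (r * t) * (2 * B / c * δ) ≤ c / 2 * (2 * B / c * δ) := by gcongr
    have h6 : c / 2 * (2 * B / c * δ) = B * δ := by field_simp
    have h7 : 16 * δ / (r * t) * (8 * t) = 128 / r * δ := by field_simp; ring
    have h8 : c * ((2 * B + 256 / r) / c * δ) = 2 * B * δ + 2 * (128 / r * δ) := by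
      field_simp; ring
    have h9 : 0 ≤ 128 / r * δ := by positivity
    refine le_of_mul_le_mul_left ?_ hc
    linarith
  · have h1 := (crude _ le_rfl).1
    have h2 : P.real {x | |x| < t} ≤ P.real {x | |x| < 32 * δ / (c * r)} :=
      measureReal_mono fun x (hx : |x| < t) => hx.trans_le h
    have h3 := gaussianMass_nonneg (2 * t)
    have h4 : 8 * (32 * δ / (c * r)) + 2 * B / c * δ = (2 * B + 256 / r) / c * δ := by
      field_simp; ring
    linarith

/-! ### Characteristic functions of normalized i.i.d. sums. -/

theorem norm_pow_sub_pow_le {a b : ℂ} {m : ℝ} (ha : ‖a‖ ≤ m) (hb : ‖b‖ ≤ m) (n : ℕ) :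
    ‖a ^ n - b ^ n‖ ≤ n * m ^ (n - 1) * ‖a - b‖ := by
  rw [← geom_sum₂_mul, norm_mul]
  refine mul_le_mul_of_nonneg_right ?_ (norm_nonneg _)
  have hm : 0 ≤ m := (norm_nonneg a).trans ha
  calc _ ≤ ∑ i ∈ Finset.range n, m ^ (n - 1) := by
        refine norm_sum_le_of_le _ fun i hi => ?_
        have hi' := Finset.mem_range.1 hi
        rw [norm_mul, norm_pow, norm_pow]
        calc _ ≤ m ^ i * m ^ (n - 1 - i) := by gcongr
          _ = m ^ (n - 1) := by rw [← pow_add]; congr 1; omega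
    _ = _ := by simp

variable {Ω : Type*} [MeasurableSpace Ω]

theorem norm_integral_exp_sub_le {μ : Measure Ω} [IsProbabilityMeasure μ] {Y : Ω → ℝ}
    (hY : Measurable Y) {B : ℝ} (hB : ∀ ω, |Y ω| ≤ B) (h1 : ∫ ω, Y ω ∂μ = 0)
    (h2 : ∫ ω, Y ω ^ 2 ∂μ = 1) {s : ℝ} (hs : 0 ≤ s) (hsB : s * B ≤ 1) :
    ‖∫ ω, Complex.exp ((s * Y ω : ℝ) * Complex.I) ∂μ - ((1 - s ^ 2 / 2 : ℝ) : ℂ)‖ ≤ B ^ 3 * s ^ 3 := by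
  have hYi : Integrable Y μ := (integrable_const B).mono' hY.aestronglyMeasurable
    (Filter.Eventually.of_forall hB)
  have hY2 : Integrable (fun ω => Y ω ^ 2) μ :=
    (integrable_const (B ^ 2)).mono' (hY.pow_const 2).aestronglyMeasurable
      (Filter.Eventually.of_forall fun ω => by
        rw [norm_pow]; exact pow_le_pow_left₀ (norm_nonneg _) (hB ω) 2)
  have he : Integrable (fun ω => Complex.exp ((s * Y ω : ℝ) * Complex.I)) μ := by
    refine (integrable_const (1 : ℝ)).mono' ?_
      (Filter.Eventually.of_forall fun ω => by rw [Complex.norm_exp_ofReal_mul_I])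
    exact Measurable.aestronglyMeasurable (by fun_prop)
  have hl : Integrable (fun ω => s * Complex.I * (Y ω : ℂ)) μ := hYi.ofReal.const_mul _
  have hq : Integrable (fun ω => (s : ℂ) ^ 2 / 2 * ((Y ω ^ 2 : ℝ) : ℂ)) μ :=
    hY2.ofReal.const_mul _
  have hlin : Integrable (fun ω => (1 : ℂ) + s * Complex.I * (Y ω : ℂ)) μ :=
    (integrable_const (1 : ℂ)).add hl
  have hpi : ∫ ω, ((1 : ℂ) + s * Complex.I * (Y ω : ℂ) - s ^ 2 / 2 * ((Y ω ^ 2 : ℝ) : ℂ)) ∂μ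
      = ((1 - s ^ 2 / 2 : ℝ) : ℂ) := by
    rw [integral_sub hlin hq, integral_add (integrable_const _) hl, integral_const_mul,
      integral_const_mul, integral_complex_ofReal, integral_complex_ofReal, h1, h2]
    simp
  have hp : Integrable (fun ω => (1 : ℂ) + s * Complex.I * (Y ω : ℂ)
      - s ^ 2 / 2 * ((Y ω ^ 2 : ℝ) : ℂ)) μ := hlin.sub hq
  rw [← hpi, ← integral_sub he hp]
  refine (norm_integral_le_of_norm_le_const (C := B ^ 3 * s ^ 3)
    (Filter.Eventually.of_forall fun ω => ?_)).trans (by simp)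
  have hsY : |s * Y ω| ≤ s * B := by
    rw [abs_mul, abs_of_nonneg hs]; exact mul_le_mul_of_nonneg_left (hB ω) hs
  have hn : ‖((s * Y ω : ℝ) : ℂ) * Complex.I‖ = |s * Y ω| := by simp
  have h := Complex.exp_bound (x := ((s * Y ω : ℝ) : ℂ) * Complex.I) (by rw [hn]; linarith)
    (n := 3) (by norm_num)
  rw [hn] at h
  have hsum : ∑ m ∈ Finset.range 3, (((s * Y ω : ℝ) : ℂ) * Complex.I) ^ m / (m.factorial : ℂ)
      = (1 : ℂ) + s * Complex.I * (Y ω : ℂ) - s ^ 2 / 2 * ((Y ω ^ 2 : ℝ) : ℂ) := by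
    simp only [Finset.sum_range_succ, Finset.sum_range_zero, Nat.factorial, mul_pow, Complex.I_sq]
    push_cast
    ring
  rw [hsum] at h
  refine h.trans ?_
  have h3 : |s * Y ω| ^ 3 ≤ (s * B) ^ 3 := pow_le_pow_left₀ (abs_nonneg _) hsY 3
  have h4 : 0 ≤ |s * Y ω| ^ 3 := by positivity
  norm_num [Nat.factorial]
  rw [abs_mul] at *
  nlinarith

/-- Both bases agree with `1 - s²/2` up to `O(s³)`. For `s ≤ 1 / (4B³)` the cubic error is at most
`s²/4`, so both have modulus at most `exp (-s²/4)`, and the difference of powers telescopes. -/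
theorem norm_integral_exp_pow_sub_le {μ : Measure Ω} [IsProbabilityMeasure μ] {Y : Ω → ℝ}
    (hY : Measurable Y) {B : ℝ} (hB1 : 1 ≤ B) (hB : ∀ ω, |Y ω| ≤ B) (h1 : ∫ ω, Y ω ∂μ = 0)
    (h2 : ∫ ω, Y ω ^ 2 ∂μ = 1) {s : ℝ} (hs : 0 ≤ s) (hsB : s ≤ 1 / (4 * B ^ 3)) (n : ℕ) :
    ‖(∫ ω, Complex.exp ((s * Y ω : ℝ) * Complex.I) ∂μ) ^ n - (Real.exp (-s ^ 2 / 2) : ℂ) ^ n‖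
      ≤ 2 * (B ^ 3 + 1) * (n * s ^ 3) * Real.exp (-(n * s ^ 2) / 4) := by
  rcases Nat.eq_zero_or_pos n with rfl | hn
  · simp
  have hB3 : B ≤ B ^ 3 := le_self_pow₀ hB1 (by norm_num)
  have hsB' : 4 * (B ^ 3 * s) ≤ 1 := by
    rw [le_div_iff₀ (by positivity)] at hsB; linarith
  have hs1 : s ≤ 1 := by nlinarith
  have hsB1 : s * B ≤ 1 := by nlinarith
  set f := ∫ ω, Complex.exp ((s * Y ω : ℝ) * Complex.I) ∂μ with hf
  have hA := norm_integral_exp_sub_le hY hB h1 h2 hs hsB1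
  rw [← hf] at hA
  have hs2 : s ^ 2 ≤ 1 := pow_le_one₀ hs hs1
  have hg : ‖((1 - s ^ 2 / 2 : ℝ) : ℂ) - (Real.exp (-s ^ 2 / 2) : ℂ)‖ ≤ s ^ 3 := by
    rw [← Complex.ofReal_sub, Complex.norm_real, Real.norm_eq_abs, abs_sub_comm]
    have h := Real.abs_exp_sub_one_sub_id_le (x := -s ^ 2 / 2) (by
      rw [abs_le]; constructor <;> nlinarith [sq_nonneg s])
    rw [show Real.exp (-s ^ 2 / 2) - 1 - -s ^ 2 / 2 = Real.exp (-s ^ 2 / 2) - (1 - s ^ 2 / 2)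
      by ring] at h
    refine h.trans ?_
    have : s ^ 3 * s ≤ s ^ 3 * 1 := by gcongr
    nlinarith [pow_nonneg hs 3]
  have hd : ‖f - (Real.exp (-s ^ 2 / 2) : ℂ)‖ ≤ (B ^ 3 + 1) * s ^ 3 := by
    have := norm_sub_le_norm_sub_add_norm_sub f ((1 - s ^ 2 / 2 : ℝ) : ℂ)
      (Real.exp (-s ^ 2 / 2) : ℂ)
    linarith
  have hfm : ‖f‖ ≤ Real.exp (-s ^ 2 / 4) := by
    have h3 : ‖f‖ ≤ B ^ 3 * s ^ 3 + (1 - s ^ 2 / 2) := by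
      have := norm_le_norm_sub_add f ((1 - s ^ 2 / 2 : ℝ) : ℂ)
      rw [Complex.norm_real, Real.norm_of_nonneg (by linarith)] at this
      linarith
    have h4 : B ^ 3 * s ^ 3 ≤ s ^ 2 / 4 := by nlinarith [sq_nonneg s]
    have h5 := Real.add_one_le_exp (-s ^ 2 / 4)
    linarith
  have hgm : ‖(Real.exp (-s ^ 2 / 2) : ℂ)‖ ≤ Real.exp (-s ^ 2 / 4) := by
    rw [Complex.norm_real, Real.norm_of_nonneg (Real.exp_pos _).le, Real.exp_le_exp]
    nlinarith [sq_nonneg s]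
  refine (norm_pow_sub_pow_le hfm hgm n).trans ?_
  -- Replacing the exponent `n - 1` by `n` costs `exp (s²/4) ≤ 2`.
  have he : Real.exp (-s ^ 2 / 4) ^ (n - 1) ≤ 2 * Real.exp (-(n * s ^ 2) / 4) := by
    rw [← Real.exp_nat_mul, Nat.cast_sub hn, Nat.cast_one,
      show ((n : ℝ) - 1) * (-s ^ 2 / 4) = s ^ 2 / 4 + -(n * s ^ 2) / 4 by ring, Real.exp_add]
    refine mul_le_mul_of_nonneg_right ?_ (Real.exp_pos _).le
    have h6 : Real.exp (s ^ 2 / 4) ^ 4 ≤ 2 ^ 4 := by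
      rw [← Real.exp_nat_mul]
      have h7 : Real.exp ((4 : ℕ) * (s ^ 2 / 4)) ≤ Real.exp 1 := by
        rw [Real.exp_le_exp]; push_cast; linarith
      have := Real.exp_one_lt_d9
      refine h7.trans (le_of_lt (this.trans ?_))
      norm_num
    exact le_of_pow_le_pow_left₀ (by norm_num) (by norm_num) h6
  calc _ ≤ n * (2 * Real.exp (-(n * s ^ 2) / 4)) * ((B ^ 3 + 1) * s ^ 3) := by gcongr
    _ = _ := by ring

/-- A one-sided Berry–Esseen bound for bounded i.i.d. variables, with a factor `2` to spare in the
Gaussian mass. -/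
theorem exists_pi_measureReal_abs_sum_lt_le (μ : Measure Ω) [IsProbabilityMeasure μ] {Y : Ω → ℝ}
    (hY : Measurable Y) {B : ℝ} (hB1 : 1 ≤ B) (hB : ∀ ω, |Y ω| ≤ B) (h1 : ∫ ω, Y ω ∂μ = 0)
    (h2 : ∫ ω, Y ω ^ 2 ∂μ = 1) :
    ∃ C : ℝ, ∀ D : ℕ, 0 < D → ∀ t : ℝ, 0 < t →
      (Measure.pi fun _ : Fin D => μ).real {ω | |(∑ j, Y (ω j)) / √D| < t}
        ≤ gaussianMass (2 * t) + C * (1 / √D) := by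
  have hr : 0 < 1 / (4 * B ^ 3) := by positivity
  obtain ⟨C, hC⟩ := exists_measureReal_abs_lt_le hr (A := 2 * (B ^ 3 + 1)) (by positivity)
  refine ⟨C, fun D hD t ht => ?_⟩
  have hDpos : (0 : ℝ) < D := by exact_mod_cast hD
  have hD' : 0 < √(D : ℝ) := Real.sqrt_pos.2 hDpos
  have hDsq : √(D : ℝ) ^ 2 = D := Real.sq_sqrt hDpos.le
  set S : (Fin D → Ω) → ℝ := fun ω => (∑ j, Y (ω j)) / √D with hS
  have hSm : Measurable S :=
    (Finset.measurable_sum _ fun j _ => hY.comp (measurable_pi_apply j)).div_const _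
  set P := (Measure.pi fun _ : Fin D => μ).map S with hPdef
  have : IsProbabilityMeasure P := Measure.isProbabilityMeasure_map hSm.aemeasurable
  have hmain := hC (1 / √D) (by positivity) P inferInstance ?_ t ht
  · rw [hPdef, map_measureReal_apply hSm (measurableSet_lt (by fun_prop) (by fun_prop))] at hmain
    exact hmain
  intro v hv hvr
  set s := v / √D with hs
  have hsr : s ≤ 1 / (4 * B ^ 3) := by
    rw [hs, div_le_iff₀ hD']
    refine hvr.trans (le_of_eq ?_)
    simp
  have hb := norm_integral_exp_pow_sub_le hY hB1 hB h1 h2 (by positivity : 0 ≤ s) hsr D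
  have e1 : (D : ℝ) * s ^ 2 = v ^ 2 := by rw [hs, div_pow, hDsq]; field_simp
  have e2 : (D : ℝ) * s ^ 3 = 1 / √D * v ^ 3 := by
    rw [pow_succ, ← mul_assoc, e1, hs]; ring
  have e3 : (∫ ω, Complex.exp ((s * Y ω : ℝ) * Complex.I) ∂μ) ^ D
      = ∫ ω, Complex.exp ((v * S ω : ℝ) * Complex.I) ∂(Measure.pi fun _ : Fin D => μ) := by
    have := integral_fintype_prod_eq_pow (ι := Fin D) (μ := μ)
      (fun ω => Complex.exp ((s * Y ω : ℝ) * Complex.I))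
    rw [Fintype.card_fin] at this
    rw [← this]
    congr 1 with ω
    rw [← Complex.exp_sum, ← Finset.sum_mul, ← Complex.ofReal_sum, ← Finset.mul_sum, hS, hs]
    congr 3
    ring
  have e4 : (∫ ω, Complex.exp ((v * S ω : ℝ) * Complex.I) ∂(Measure.pi fun _ : Fin D => μ)).re
      = ∫ x, Real.cos (v * x) ∂P := by
    rw [hPdef, integral_map hSm.aemeasurable
      (Continuous.aestronglyMeasurable (by fun_prop)), ← RCLike.re_eq_complex_re, ← integral_re]
    · simp only [RCLike.re_eq_complex_re, Complex.exp_ofReal_mul_I_re]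
    · refine (integrable_const (1 : ℝ)).mono' ?_
        (Filter.Eventually.of_forall fun ω => by rw [Complex.norm_exp_ofReal_mul_I])
      exact Measurable.aestronglyMeasurable (by fun_prop)
  have e5 : (Real.exp (-s ^ 2 / 2) : ℂ) ^ D = (Real.exp (-v ^ 2 / 2) : ℂ) := by
    rw [← Complex.ofReal_pow, ← Real.exp_nat_mul, ← e1]
    congr 2
    ring
  rw [e1, e2, e3, e5] at hb
  rw [← e4, ← Complex.ofReal_re (Real.exp (-v ^ 2 / 2)), ← Complex.sub_re]
  refine (Complex.abs_re_le_norm _).trans (hb.trans (le_of_eq ?_))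
  ring

/-! ### The kernel as a cosine moment of its frequency law. -/

/-- The exceptional set is a countable union of hyperplanes orthogonal to `z`, hence null. This
non-degeneracy gives both `K z < 1` and positive variance. -/
theorem ae_cos_inner_ne {d : ℕ} {μ : Measure (Space d)} (hμ : μ ≪ volume) {z : Space d}
    (hz : z ≠ 0) (c : ℝ) : ∀ᵐ ω ∂μ, Real.cos (inner ℝ ω z) ≠ c := by
  refine hμ.ae_le ?_
  have hL : Function.Surjective (innerₛₗ ℝ z) := by
    intro a
    refine ⟨(a / inner ℝ z z) • z, ?_⟩
    have : inner ℝ z z ≠ 0 := inner_self_ne_zero.2 hz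
    simp only [innerₛₗ_apply_apply, inner_smul_right]
    field_simp
  have hcount : {θ : ℝ | Real.cos θ = c}.Countable := by
    rcases Set.eq_empty_or_nonempty {θ : ℝ | Real.cos θ = c} with h | ⟨θ₀, h₀⟩
    · simp [h]
    · refine ((Set.countable_range fun k : ℤ => 2 * k * Real.pi + θ₀).union
        (Set.countable_range fun k : ℤ => 2 * k * Real.pi - θ₀)).mono fun θ (hθ : _ = c) => ?_
      have h₁ : Real.cos θ₀ = c := h₀
      obtain ⟨k, hk | hk⟩ := Real.cos_eq_cos_iff.1 (h₁.trans hθ.symm)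
      · exact Or.inl ⟨k, hk.symm⟩
      · exact Or.inr ⟨k, hk.symm⟩
  have h := (ae_comp_linearMap_mem_iff (innerₛₗ ℝ z) (volume : Measure (Space d))
    (volume : Measure ℝ) hL hcount.measurableSet.compl).2
    (compl_mem_ae_iff.2 (hcount.measure_zero volume))
  filter_upwards [h] with ω hω
  rw [real_inner_comm]
  exact hω

theorem integral_cos_inner {d : ℕ} (μ : Measure (Space d)) [IsFiniteMeasure μ] (x : Space d) :
    ∫ ω, Real.cos (inner ℝ ω x) ∂μ = (charFun μ x).re := by
  rw [charFun_apply, ← RCLike.re_eq_complex_re, ← integral_re]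
  · simp only [RCLike.re_eq_complex_re, Complex.exp_ofReal_mul_I_re]
  · refine (integrable_const (1 : ℝ)).mono' ?_
      (Filter.Eventually.of_forall fun ω => by rw [Complex.norm_exp_ofReal_mul_I])
    exact Continuous.aestronglyMeasurable (by fun_prop)

theorem integrable_cos_inner {d : ℕ} (μ : Measure (Space d)) [IsFiniteMeasure μ] (x : Space d) :
    Integrable (fun ω => Real.cos (inner ℝ ω x)) μ :=
  (integrable_const (1 : ℝ)).mono' (Continuous.aestronglyMeasurable (by fun_prop))
    (Filter.Eventually.of_forall fun _ => Real.abs_cos_le_one _)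

namespace IsFrequencyLaw

variable {d : ℕ} {K : Space d → ℝ} {μ : Measure (Space d)}

theorem eq_integral_cos (h : IsFrequencyLaw K μ) (x : Space d) :
    K x = ∫ ω, Real.cos (inner ℝ ω x) ∂μ := by
  have := h.isProbabilityMeasure
  rw [integral_cos_inner, h.charFun_eq, Complex.ofReal_re]

theorem continuous (h : IsFrequencyLaw K μ) : Continuous K := by
  have := h.isProbabilityMeasure
  have h1 : K = fun x => (charFun μ x).re := by
    ext x; rw [h.charFun_eq, Complex.ofReal_re]
  rw [h1]
  exact Complex.continuous_re.comp continuous_charFun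

theorem map_zero (h : IsFrequencyLaw K μ) : K 0 = 1 := by
  have := h.isProbabilityMeasure
  rw [h.eq_integral_cos]
  simp

theorem lt_one (h : IsFrequencyLaw K μ) {z : Space d} (hz : z ≠ 0) : K z < 1 := by
  have := h.isProbabilityMeasure
  have hi := integrable_cos_inner μ z
  have h0 : 0 ≤ fun ω : Space d => 1 - Real.cos (inner ℝ ω z) :=
    fun ω => sub_nonneg.2 (Real.cos_le_one _)
  have h1 : ∫ ω, (1 - Real.cos (inner ℝ ω z)) ∂μ = 1 - K z := by
    rw [integral_sub (integrable_const _) hi, ← h.eq_integral_cos]; simp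
  have h2 : 0 ≤ 1 - K z := h1 ▸ integral_nonneg h0
  refine lt_of_le_of_ne (by linarith) fun heq => ?_
  rw [heq, sub_self, integral_eq_zero_iff_of_nonneg h0 ((integrable_const _).sub hi)] at h1
  obtain ⟨ω, hω, hω'⟩ := (h1.and (ae_cos_inner_ne h.absolutelyContinuous hz 1)).exists
  simp only [Pi.zero_apply] at hω
  exact hω' (by linarith)

theorem integral_sq_cos_sub (h : IsFrequencyLaw K μ) (z : Space d) :
    ∫ ω, (Real.cos (inner ℝ ω z) - K z) ^ 2 ∂μ = (1 + K ((2 : ℝ) • z) - 2 * K z ^ 2) / 2 := by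
  have := h.isProbabilityMeasure
  have h1 : ∀ ω : Space d, (Real.cos (inner ℝ ω z) - K z) ^ 2
      = 1 / 2 * Real.cos (inner ℝ ω ((2 : ℝ) • z)) - 2 * K z * Real.cos (inner ℝ ω z)
        + (1 / 2 + K z ^ 2) := by
    intro ω
    rw [inner_smul_right, Real.cos_two_mul]
    ring
  have i1 := (integrable_cos_inner μ ((2 : ℝ) • z)).const_mul (1 / 2)
  have i2 := (integrable_cos_inner μ z).const_mul (2 * K z)
  have i3 : Integrable (fun ω : Space d => 1 / 2 * Real.cos (inner ℝ ω ((2 : ℝ) • z))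
      - 2 * K z * Real.cos (inner ℝ ω z)) μ := i1.sub i2
  simp_rw [h1]
  rw [integral_add i3 (integrable_const _), integral_sub i1 i2, integral_const_mul,
    integral_const_mul, ← h.eq_integral_cos, ← h.eq_integral_cos, integral_const]
  simp
  ring

theorem variance_pos (h : IsFrequencyLaw K μ) {z : Space d} (hz : z ≠ 0) :
    0 < (1 + K ((2 : ℝ) • z) - 2 * K z ^ 2) / 2 := by
  have := h.isProbabilityMeasure
  have h0 : 0 ≤ fun ω : Space d => (Real.cos (inner ℝ ω z) - K z) ^ 2 := fun ω => sq_nonneg _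
  have h1 := h.integral_sq_cos_sub z
  refine lt_of_le_of_ne (h1 ▸ integral_nonneg h0) fun heq => ?_
  rw [← heq, integral_eq_zero_iff_of_nonneg h0] at h1
  · obtain ⟨ω, hω, hω'⟩ := (h1.and (ae_cos_inner_ne h.absolutelyContinuous hz (K z))).exists
    simp only [Pi.zero_apply] at hω
    exact hω' (sub_eq_zero.1 (pow_eq_zero_iff two_ne_zero |>.1 hω))
  · have hi := integrable_cos_inner μ z
    refine (integrable_const ((1 + |K z|) ^ 2)).mono'
      (Continuous.aestronglyMeasurable (by fun_prop)) (Filter.Eventually.of_forall fun ω => ?_)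
    rw [norm_pow]
    refine pow_le_pow_left₀ (norm_nonneg _) ((norm_sub_le _ _).trans ?_) 2
    gcongr
    · exact Real.abs_cos_le_one _
    · exact le_rfl

theorem ratio_pos (h : IsFrequencyLaw K μ) {z : Space d} (hz : z ≠ 0) : 0 < ratio K z := by
  have h1 := h.variance_pos hz
  have h2 := h.lt_one hz
  have : 0 < 1 - K z := by linarith
  rw [ratio]
  refine div_pos (by linarith) (by positivity)

end IsFrequencyLaw

/-! ### Attainment of the supremum. -/

/-- Removing the origin keeps the set closed: for a bounded point, being non-zero means that some
coordinate satisfies the closed condition `ρ ≤ |x i|`. -/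
theorem isCompact_isBdd_ne_zero {d : ℕ} (Δ : ℝ) {ρ : ℝ} (hρ : 0 < ρ) :
    IsCompact {x : Space d | IsBdd Δ ρ x ∧ x ≠ 0} := by
  have heq : {x : Space d | IsBdd Δ ρ x ∧ x ≠ 0} = (⋂ i, {x : Space d | |x i| ≤ Δ})
      ∩ ((⋂ i, ({x : Space d | x i = 0} ∪ {x : Space d | ρ ≤ |x i|}))
      ∩ ⋃ i, {x : Space d | ρ ≤ |x i|}) := by
    ext x
    simp only [IsBdd, Set.mem_ofPred_eq, Set.mem_inter_iff, Set.mem_iInter, Set.mem_union,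
      Set.mem_iUnion, and_assoc]
    refine and_congr_right fun _ => ?_
    constructor
    · rintro ⟨h1, h2⟩
      refine ⟨fun i => or_iff_not_imp_left.2 (h1 i), ?_⟩
      by_contra! hcon
      refine h2 (PiLp.ext fun i => ?_)
      by_contra hi
      exact absurd (h1 i hi) (not_le.2 (hcon i))
    · rintro ⟨h1, i, hi⟩
      refine ⟨fun i hi => (h1 i).resolve_left hi, ?_⟩
      rintro rfl
      simp at hi
      linarith
  refine Metric.isCompact_of_isClosed_isBounded ?_ ?_
  · rw [heq]
    refine (isClosed_iInter fun i => isClosed_le (by fun_prop) (by fun_prop)).inter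
      ((isClosed_iInter fun i => (isClosed_eq (by fun_prop) (by fun_prop)).union
        (isClosed_le (by fun_prop) (by fun_prop))).inter
        (isClosed_iUnion_of_finite fun i => isClosed_le (by fun_prop) (by fun_prop)))
  · refine (Metric.isBounded_closedBall (x := (0 : Space d)) (r := √(∑ _i : Fin d, Δ ^ 2))).subset
      fun x hx => ?_
    rw [mem_closedBall_zero_iff, EuclideanSpace.norm_eq]
    refine Real.sqrt_le_sqrt (Finset.sum_le_sum fun i _ => ?_)
    exact pow_le_pow_left₀ (norm_nonneg _) (hx.1.1 i) 2

theorem exists_isGreatest_ratioValues {d : ℕ} (hd : 0 < d) {K : Space d → ℝ}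
    {μ : Measure (Space d)} (h : IsFrequencyLaw K μ) {Δ ρ : ℝ} (hρ : 0 < ρ) (hΔ : ρ ≤ Δ) :
    ∃ z : Space d, IsBdd Δ ρ z ∧ z ≠ 0 ∧ IsGreatest (ratioValues K Δ ρ) (ratio K z) := by
  have hne : {x : Space d | IsBdd Δ ρ x ∧ x ≠ 0}.Nonempty := by
    refine ⟨EuclideanSpace.single ⟨0, hd⟩ ρ, ⟨fun i => ?_, fun i hi => ?_⟩, ?_⟩
    · simp only [PiLp.single_apply]
      split_ifs
      · rwa [abs_of_pos hρ]
      · simp; linarith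
    · simp only [PiLp.single_apply] at hi ⊢
      split_ifs with h0
      · exact le_abs_self ρ
      · simp [h0] at hi
    · simpa using hρ.ne'
  have hcont : ContinuousOn (ratio K) {x : Space d | IsBdd Δ ρ x ∧ x ≠ 0} := by
    have hK := h.continuous
    unfold ratio
    refine ContinuousOn.div (by fun_prop) (by fun_prop) fun x hx => ?_
    have := h.lt_one hx.2
    have : 0 < 1 - K x := by linarith
    positivity
  obtain ⟨z, hz, hmax⟩ := (isCompact_isBdd_ne_zero Δ hρ).exists_isMaxOn hne hcont
  refine ⟨z, hz.1, hz.2, ⟨z, hz, rfl⟩, ?_⟩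
  rintro _ ⟨x, hx, rfl⟩
  exact hmax hx

/-! ### Squared distances and the final estimate. -/

theorem dist_sq_featureMap {d : ℕ} {H : Type*} [NormedAddCommGroup H] [InnerProductSpace ℝ H]
    {K : Space d → ℝ} {φ : Space d → H} (hφ : IsFeatureMap K φ) (hK : K 0 = 1) (x y : Space d) :
    dist (φ x) (φ y) ^ 2 = 2 * (1 - K (x - y)) := by
  rw [dist_eq_norm, norm_sub_sq_real, hφ, ← real_inner_self_eq_norm_sq,
    ← real_inner_self_eq_norm_sq, hφ, hφ, sub_self, sub_self, hK]
  ring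

theorem dist_sq_features_zero {d D : ℕ} (ω : Fin D → Space d) (z : Space d) :
    dist (features ω z) (features ω 0) ^ 2
      = 1 / D * ∑ j, 2 * (1 - Real.cos (inner ℝ (ω j) z)) := by
  rw [EuclideanSpace.dist_eq, Real.sq_sqrt (by positivity), Fintype.sum_prod_type, Finset.mul_sum]
  refine Finset.sum_congr rfl fun j _ => ?_
  simp only [features, Fin.sum_univ_two, Real.dist_eq, sq_abs, ← mul_sub, mul_pow]
  rw [Real.sq_sqrt (by positivity)]
  simp only [Matrix.cons_val_zero, Matrix.cons_val_one, inner_zero_right, Real.sin_zero,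
    Real.cos_zero]
  have := Real.sin_sq_add_cos_sq (inner ℝ (ω j) z)
  rw [← mul_add]
  congr 1
  linarith

/-- Otherwise `b < 2a`, so `a + b < 3a` in the factorization of `a² - b²`. -/
theorem le_abs_sub_of_le_abs_sq_sub {a b ε : ℝ} (ha : 0 < a) (hb : 0 ≤ b) (hε : ε < 1)
    (h : 3 * ε * a ^ 2 ≤ |a ^ 2 - b ^ 2|) : ε * a ≤ |a - b| := by
  by_contra! hlt
  have h1 := abs_lt.1 hlt
  have h2 : a + b < 3 * a := by nlinarith
  have h3 : |a ^ 2 - b ^ 2| = |a - b| * (a + b) := by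
    rw [sq_sub_sq, abs_mul, abs_of_pos (by linarith : 0 < a + b)]
    ring
  have h4 : |a - b| * (a + b) ≤ |a - b| * (3 * a) := by gcongr
  have h5 : |a - b| * (3 * a) < ε * a * (3 * a) := by gcongr
  nlinarith

end RFF

theorem theorem4p1 {d : ℕ} (hd : 0 < d) {H : Type*} [NormedAddCommGroup H]
    [InnerProductSpace ℝ H] (K : RFF.Space d → ℝ) (φ : RFF.Space d → H)
    (hφ : RFF.IsFeatureMap K φ) (μ : MeasureTheory.Measure (RFF.Space d))
    (hμ : RFF.IsFrequencyLaw K μ) (Δ ρ : ℝ) (hρ : 0 < ρ) (hΔ : ρ ≤ Δ) :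
    IsLUB (RFF.ratioValues K Δ ρ) (RFF.ratioSup K Δ ρ) ∧ 0 < RFF.ratioSup K Δ ρ ∧
    ∃ x y : RFF.Space d, RFF.IsBdd Δ ρ x ∧ RFF.IsBdd Δ ρ y ∧ 0 < dist (φ x) (φ y) ∧
      ∃ C : ℝ, ∀ ε : ℝ, 0 < ε → ε < 1 → ∀ D : ℕ, 0 < D →
        2 * RFF.gaussianTail (6 * ε * √((D : ℝ) / RFF.ratioSup K Δ ρ))
            - C * (D : ℝ) ^ (-(1 / 2) : ℝ) ≤
          (RFF.sampleLaw μ D).real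
            {ω | ε * dist (φ x) (φ y) ≤
              |dist (φ x) (φ y) - dist (RFF.features ω x) (RFF.features ω y)|} := by
  obtain ⟨z, hzb, hz, hgr⟩ := RFF.exists_isGreatest_ratioValues hd hμ hρ hΔ
  have hsup : RFF.ratioSup K Δ ρ = RFF.ratio K z := hgr.csSup_eq
  rw [hsup]
  refine ⟨hgr.isLUB, hμ.ratio_pos hz, z, 0, hzb, ⟨fun i => ?_, fun i hi => ?_⟩, ?_⟩
  · simpa using hρ.le.trans hΔ
  · simp at hi
  have hprob := hμ.isProbabilityMeasure
  have hK1 : 0 < 1 - K z := sub_pos.2 (hμ.lt_one hz)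
  have hdist := RFF.dist_sq_featureMap hφ hμ.map_zero z 0
  rw [sub_zero] at hdist
  have hdpos : 0 < dist (φ z) (φ 0) := by
    refine lt_of_le_of_ne dist_nonneg fun h0 => ?_
    rw [← h0] at hdist
    linarith
  refine ⟨hdpos, ?_⟩
  have hvar := hμ.variance_pos hz
  set τ := √((1 + K ((2 : ℝ) • z) - 2 * K z ^ 2) / 2) with hτ
  have hτ0 : 0 < τ := Real.sqrt_pos.2 hvar
  have hτ2 : τ ^ 2 = (1 + K ((2 : ℝ) • z) - 2 * K z ^ 2) / 2 := Real.sq_sqrt hvar.le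
  have hratio : RFF.ratio K z = (τ / (1 - K z)) ^ 2 := by
    rw [div_pow, hτ2, RFF.ratio]
    field_simp
  set Y : RFF.Space d → ℝ := fun ω => (Real.cos (inner ℝ ω z) - K z) / τ with hY
  have hYm : Measurable Y := Continuous.measurable (by fun_prop)
  -- The extra `1` only secures the requirement `1 ≤ B`.
  have hYB : ∀ ω, |Y ω| ≤ 1 + (1 + |K z|) / τ := by
    intro ω
    have h1 : |Real.cos (inner ℝ ω z) - K z| ≤ 1 + |K z| :=
      (abs_sub _ _).trans (add_le_add_left (Real.abs_cos_le_one _) _)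
    have h2 : |Y ω| ≤ (1 + |K z|) / τ := by
      rw [hY]
      simp only [abs_div, abs_of_pos hτ0]
      gcongr
    linarith
  have hY1 : ∫ ω, Y ω ∂μ = 0 := by
    rw [hY, MeasureTheory.integral_div, MeasureTheory.integral_sub
      (RFF.integrable_cos_inner μ z) (MeasureTheory.integrable_const _), ← hμ.eq_integral_cos]
    simp
  have hY2 : ∫ ω, Y ω ^ 2 ∂μ = 1 := by
    simp_rw [hY, div_pow]
    rw [MeasureTheory.integral_div, hμ.integral_sq_cos_sub, hτ2, div_self hvar.ne']
  obtain ⟨C, hC⟩ := RFF.exists_pi_measureReal_abs_sum_lt_le μ hYm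
    (le_add_of_nonneg_right (by positivity)) hYB hY1 hY2
  refine ⟨C, fun ε hε hε1 D hD => ?_⟩
  have hDpos : (0 : ℝ) < D := by exact_mod_cast hD
  have hD' : 0 < √(D : ℝ) := Real.sqrt_pos.2 hDpos
  have hDsq : √(D : ℝ) * √(D : ℝ) = D := Real.mul_self_sqrt hDpos.le
  -- Chosen so that `2τ / √D * t` equals `3ε` times the squared kernel distance `2 (1 - K z)`.
  set t := 3 * ε * (√(D : ℝ) * (1 - K z) / τ) with ht
  have ht0 : 0 < t := by positivity
  have hpow : (D : ℝ) ^ (-(1 / 2) : ℝ) = 1 / √D := by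
    rw [Real.rpow_neg hDpos.le, ← Real.sqrt_eq_rpow, one_div]
  have h2t : 6 * ε * √((D : ℝ) / RFF.ratio K z) = 2 * t := by
    rw [hratio, Real.sqrt_div hDpos.le, Real.sqrt_sq (by positivity), ht]
    field_simp
    ring
  have hmass := RFF.gaussianMass_add_gaussianTail (s := 2 * t) (by positivity)
  have hCt := hC D hD t ht0
  rw [hpow, h2t]
  have hm : MeasurableSet {ω : Fin D → RFF.Space d | |(∑ j, Y (ω j)) / √D| < t} :=
    measurableSet_lt (by fun_prop) (by fun_prop)
  have hcompl := MeasureTheory.probReal_compl_eq_one_sub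
    (μ := MeasureTheory.Measure.pi fun _ : Fin D => μ) hm
  have hsub : {ω : Fin D → RFF.Space d | |(∑ j, Y (ω j)) / √D| < t}ᶜ ⊆
      {ω | ε * dist (φ z) (φ 0) ≤
        |dist (φ z) (φ 0) - dist (RFF.features ω z) (RFF.features ω 0)|} := by
    intro ω hω
    have hω' : t ≤ |(∑ j, Y (ω j)) / √D| := not_lt.1 hω
    refine RFF.le_abs_sub_of_le_abs_sq_sub hdpos dist_nonneg hε1 ?_
    have h1 : dist (φ z) (φ 0) ^ 2 - dist (RFF.features ω z) (RFF.features ω 0) ^ 2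
        = 2 * τ / √D * ((∑ j, Y (ω j)) / √D) := by
      rw [hdist, RFF.dist_sq_features_zero, hY, ← Finset.sum_div, ← Finset.mul_sum,
        Finset.sum_sub_distrib, Finset.sum_sub_distrib]
      simp only [Finset.sum_const, Finset.card_univ, Fintype.card_fin, nsmul_eq_mul]
      rw [div_mul_div_comm, hDsq]
      field_simp
      ring
    rw [h1, abs_mul, abs_of_pos (by positivity : 0 < 2 * τ / √D), hdist]
    calc 3 * ε * (2 * (1 - K z)) = 2 * τ / √D * t := by rw [ht]; field_simp
      _ ≤ _ := by gcongr
  have hle := MeasureTheory.measureReal_mono (μ := MeasureTheory.Measure.pi fun _ : Fin D => μ) hsub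
  rw [RFF.sampleLaw]
  linarith
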